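/- Write $X,Y,Z$ for the $2\times2$ Pauli matrices and let $P_n$ be the $n$-qubit Pauli group, i.e. the set of all tensor products $\sigma_1\otimes\cdots\otimes\sigma_n$ with each $\sigma_j\in\{i^kI,\,i^kX,\,i^kY,\,i^kZ : 0\le k\le 3\}$. A Clifford unitary on $n$ qubits is a unitary $U$ on $(\mathbb{C}^2)^{\otimes n}$ with $UP_nU^\dagger=P_n$, and a stabilizer state is a vector of the form $U|0^n\rangle$ with $U$ a Clifford unitary. The stabilizer rank $\chi(\varphi)$ of $\varphi\in(\mathbb{C}^2)^{\otimes n}$ is the least $r$ such that $\varphi=\sum_{j=1}^r c_j\varphi_j$ for some $c_j\in\mathbb{C}$ and stabilizer states $\varphi_j$. For $\delta>0$ and a state $\psi$, the $\delta$-approximate stabilizer rank $\chi_\delta(\psi)$ is the minimum of $\chi(\varphi)$ over all states (unit vectors) $\varphi\in(\mathbb{C}^2)^{\otimes n}$ with $\|\psi-\varphi\|_2\le\delta$. Let $$|H\rangle=\cos(\pi/8)|0\rangle+\sin(\pi/8)|1\rangle,\qquad |R\rangle=\cos(\beta)|0\rangle+e^{i\pi/4}\sin(\beta)|1\rangle,\qquad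 \beta=\tfrac12\arccos(1/\sqrt3).$$ Theorem 4.7. There is an absolute constant $\delta>0$ such that, for $|B\rangle$ either $|H\rangle$ or $|R\rangle$, $$\chi_\delta\bigl(|B\rangle^{\otimes n}\bigr)=\Omega\!\left(\frac{\sqrt n}{\log n}\right),$$ that is, there are a constant $c>0$ and an $N$ such that $\chi_\delta(|B\rangle^{\otimes n})\ge c\,\sqrt n/\log n$ for all $n\ge N$. -/

import Mathlib

namespace StabRank

open Complex

/-- Labels `x ∈ 𝔽₂ⁿ` of the computational basis of `n` qubits. -/
abbrev Bits (n : ℕ) : Type := Fin n → Fin 2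

/-- The `n`-qubit Hilbert space `ℂ^(2ⁿ)` with its `ℓ²` norm; the coordinate of `ψ` at `x` is the
coefficient of `|x⟩`. -/
abbrev QSpace (n : ℕ) : Type := EuclideanSpace ℂ (Bits n)

/-- `n`-qubit operators, written in the computational basis. -/
abbrev QMat (n : ℕ) : Type := Matrix (Bits n) (Bits n) ℂ

def pauliX : Matrix (Fin 2) (Fin 2) ℂ := !![0, 1; 1, 0]

def pauliY : Matrix (Fin 2) (Fin 2) ℂ := !![0, -I; I, 0]

def pauliZ : Matrix (Fin 2) (Fin 2) ℂ := !![1, 0; 0, -1]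

/-- The 16 elements `i^k 1, i^k X, i^k Y, i^k Z` of the single-qubit Pauli group. -/
def pauliOne : Set (Matrix (Fin 2) (Fin 2) ℂ) :=
  {σ | ∃ k : ℕ, ∃ P ∈ ({1, pauliX, pauliY, pauliZ} : Set (Matrix (Fin 2) (Fin 2) ℂ)),
    σ = I ^ k • P}

/-- The tensor product `σ₁ ⊗ ⋯ ⊗ σₙ` of one-qubit operators. -/
def tensorMat {n : ℕ} (σ : Fin n → Matrix (Fin 2) (Fin 2) ℂ) : QMat n :=
  Matrix.of fun x y => ∏ j, σ j (x j) (y j)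

/-- The `n`-qubit Pauli group. -/
def pauliGroup (n : ℕ) : Set (QMat n) :=
  {P | ∃ σ : Fin n → Matrix (Fin 2) (Fin 2) ℂ, (∀ j, σ j ∈ pauliOne) ∧ P = tensorMat σ}

/-- `U` is an `n`-qubit Clifford unitary: it is unitary and `U Pₙ U† = Pₙ`. -/
def IsClifford {n : ℕ} (U : QMat n) : Prop :=
  U ∈ Matrix.unitaryGroup (Bits n) ℂ ∧ (fun P => U * P * star U) '' pauliGroup n = pauliGroup n

/-- The computational basis state `|x⟩`. -/
noncomputable def ket {n : ℕ} (x : Bits n) : QSpace n := EuclideanSpace.single x 1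

/-- Stabilizer states are the vectors `U |0ⁿ⟩` with `U` a Clifford unitary. -/
def IsStabilizerState {n : ℕ} (φ : QSpace n) : Prop :=
  ∃ U : QMat n, IsClifford U ∧ φ = Matrix.toEuclideanLin U (ket 0)

/-- `ψ` is a linear combination of `r` stabilizer states. -/
def HasStabilizerDecomposition {n : ℕ} (ψ : QSpace n) (r : ℕ) : Prop :=
  ∃ (c : Fin r → ℂ) (φ : Fin r → QSpace n),
    (∀ j, IsStabilizerState (φ j)) ∧ ψ = ∑ j, c j • φ j

/-- The stabilizer rank `χ(ψ)`. -/
noncomputable def stabilizerRank {n : ℕ} (ψ : QSpace n) : ℕ :=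
  sInf {r : ℕ | HasStabilizerDecomposition ψ r}

/-- The `δ`-approximate stabilizer rank `χ_δ(ψ)`: the minimum of `χ(φ)` over all states (unit
vectors) `φ` with `‖ψ - φ‖₂ ≤ δ`. -/
noncomputable def approxStabilizerRank {n : ℕ} (δ : ℝ) (ψ : QSpace n) : ℕ :=
  sInf {r : ℕ | ∃ φ : QSpace n, ‖φ‖ = 1 ∧ ‖ψ - φ‖ ≤ δ ∧ r = stabilizerRank φ}

/-- The tensor power `|B⟩^{⊗n}` of a one-qubit vector. -/
noncomputable def tensorPow (n : ℕ) (B : EuclideanSpace ℂ (Fin 2)) : QSpace n :=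
  WithLp.toLp 2 fun x => ∏ j, B (x j)

/-- `|H⟩ = cos(π/8)|0⟩ + sin(π/8)|1⟩`. -/
noncomputable def magicH : EuclideanSpace ℂ (Fin 2) :=
  !₂[(Real.cos (Real.pi / 8) : ℂ), (Real.sin (Real.pi / 8) : ℂ)]

/-- The angle `β = arccos(1/√3)/2`. -/
noncomputable def magicAngle : ℝ := Real.arccos (1 / Real.sqrt 3) / 2

/-- `|R⟩ = cos(β)|0⟩ + e^{iπ/4} sin(β)|1⟩`. -/
noncomputable def magicR : EuclideanSpace ℂ (Fin 2) :=
  !₂[(Real.cos magicAngle : ℂ), exp (I * (Real.pi / 4)) * (Real.sin magicAngle : ℂ)]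

/-! Every vector has a stabilizer decomposition and the states `|H⟩^{⊗n}`, `|R⟩^{⊗n}` are unit
vectors, so that the minima above are taken over nonempty sets. -/

theorem tensorMat_mul {n : ℕ} (σ τ : Fin n → Matrix (Fin 2) (Fin 2) ℂ) :
    tensorMat σ * tensorMat τ = tensorMat fun j => σ j * τ j := by
  ext x y
  simp only [tensorMat, Matrix.mul_apply, Matrix.of_apply, ← Finset.prod_mul_distrib]
  rw [Finset.prod_univ_sum]
  simp

theorem tensorMat_star {n : ℕ} (σ : Fin n → Matrix (Fin 2) (Fin 2) ℂ) :
    star (tensorMat σ) = tensorMat fun j => star (σ j) := by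
  ext x y
  simp [tensorMat, Matrix.star_apply]

theorem tensorMat_one {n : ℕ} :
    (tensorMat fun _ => 1 : QMat n) = 1 := by
  ext x y
  by_cases h : x = y
  · subst h; simp [tensorMat]
  · obtain ⟨j, hj⟩ := Function.ne_iff.mp h
    simp only [tensorMat, Matrix.of_apply, Matrix.one_apply_ne h]
    exact Finset.prod_eq_zero (Finset.mem_univ j) (Matrix.one_apply_ne hj)

theorem pauliX_conj_mem {σ : Matrix (Fin 2) (Fin 2) ℂ} (h : σ ∈ pauliOne) :
    pauliX * σ * pauliX ∈ pauliOne := by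
  obtain ⟨k, P, hP, rfl⟩ := h
  have e : pauliX * I ^ k • P * pauliX = I ^ k • (pauliX * P * pauliX) := by simp
  rw [e]
  rcases hP with rfl | rfl | rfl | rfl
  · exact ⟨k, 1, by simp, by ext i j; fin_cases i <;> fin_cases j <;> simp [pauliX]⟩
  · exact ⟨k, pauliX, by simp, by ext i j; fin_cases i <;> fin_cases j <;> simp [pauliX]⟩
  · refine ⟨k + 2, pauliY, by simp, ?_⟩
    ext i j; fin_cases i <;> fin_cases j <;> simp [pauliX, pauliY, pow_add]
  · refine ⟨k + 2, pauliZ, by simp, ?_⟩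
    ext i j; fin_cases i <;> fin_cases j <;> simp [pauliX, pauliZ, pow_add]

theorem isStabilizerState_ket {n : ℕ} (x : Bits n) : IsStabilizerState (ket x) := by
  set u : Fin n → Matrix (Fin 2) (Fin 2) ℂ := fun j => if x j = 0 then 1 else pauliX with hu
  have hX : pauliX * pauliX = 1 := by
    ext i j; fin_cases i <;> fin_cases j <;> simp [pauliX]
  have hXs : star pauliX = pauliX := by
    ext i j; fin_cases i <;> fin_cases j <;> simp [pauliX, Matrix.star_apply]
  have us : ∀ j, star (u j) = u j := by
    intro j; simp only [hu]; split_ifs <;> simp [hXs]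
  have uu : ∀ j, u j * u j = 1 := by
    intro j; simp only [hu]; split_ifs <;> simp [hX]
  have Us : star (tensorMat u) = tensorMat u := by simp [tensorMat_star, us]
  have UU : tensorMat u * tensorMat u = 1 := by simp [tensorMat_mul, uu, tensorMat_one]
  have conj : ∀ P ∈ pauliGroup n, tensorMat u * P * tensorMat u ∈ pauliGroup n := by
    rintro P ⟨σ, hσ, rfl⟩
    refine ⟨fun j => u j * σ j * u j, fun j => ?_, by simp [tensorMat_mul]⟩
    simp only [hu]
    split_ifs
    · simpa using hσ j
    · exact pauliX_conj_mem (hσ j)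
  refine ⟨tensorMat u, ⟨?_, ?_⟩, ?_⟩
  · rw [Matrix.mem_unitaryGroup_iff, Us, UU]
  · rw [Us]
    apply Set.Subset.antisymm
    · rintro _ ⟨P, hP, rfl⟩
      exact conj P hP
    · intro P hP
      refine ⟨_, conj P hP, ?_⟩
      calc tensorMat u * (tensorMat u * P * tensorMat u) * tensorMat u
          = (tensorMat u * tensorMat u) * P * (tensorMat u * tensorMat u) := by
            simp only [Matrix.mul_assoc]
        _ = P := by simp [UU]
  · ext y
    have h01 : ∀ a : Fin 2, a = 0 ∨ a = 1 := by decide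
    have hent : ∀ j, u j (y j) 0 = if y j = x j then 1 else 0 := by
      intro j
      rcases h01 (x j) with h | h <;> rcases h01 (y j) with h' | h' <;>
        simp [hu, h, h', pauliX]
    simp only [ket, Matrix.toEuclideanLin, PiLp.single_apply]
    simp [tensorMat, hent, Finset.prod_ite_zero, funext_iff]

theorem exists_hasStabilizerDecomposition {n : ℕ} (ψ : QSpace n) :
    ∃ r, HasStabilizerDecomposition ψ r := by
  let e := Fintype.equivFin (Bits n)
  refine ⟨Fintype.card (Bits n), fun j => ψ (e.symm j), fun j => ket (e.symm j),
    fun j => isStabilizerState_ket _, ?_⟩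
  rw [Equiv.sum_comp e.symm (fun x => ψ x • ket x)]
  ext y
  simp [ket, Finset.sum_apply, Pi.single_apply]

theorem norm_tensorPow (n : ℕ) {B : EuclideanSpace ℂ (Fin 2)} (hB : ‖B‖ = 1) :
    ‖tensorPow n B‖ = 1 := by
  have h : ∑ i, ‖B i‖ ^ 2 = 1 := by rw [← EuclideanSpace.norm_sq_eq, hB]; norm_num
  have h2 : ‖tensorPow n B‖ ^ 2 = 1 := by
    rw [EuclideanSpace.norm_sq_eq]
    simp only [tensorPow, norm_prod, ← Finset.prod_pow]
    have := Finset.prod_univ_sum (fun _ : Fin n => (Finset.univ : Finset (Fin 2)))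
      (fun _ i => ‖B i‖ ^ 2)
    simp only [h, Finset.prod_const_one, Fintype.piFinset_univ] at this
    exact this.symm
  nlinarith [norm_nonneg (tensorPow n B)]

theorem norm_magicH : ‖magicH‖ = 1 := by
  have : ‖magicH‖ ^ 2 = 1 := by
    rw [EuclideanSpace.norm_sq_eq]
    simp [magicH, -Complex.ofReal_cos, -Complex.ofReal_sin, -Real.cos_pi_div_eight,
      -Real.sin_pi_div_eight]
  nlinarith [norm_nonneg magicH]

theorem norm_magicR : ‖magicR‖ = 1 := by
  have : ‖magicR‖ ^ 2 = 1 := by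
    rw [EuclideanSpace.norm_sq_eq]
    simp [magicR, -Complex.ofReal_cos, -Complex.ofReal_sin, Complex.norm_exp]
  nlinarith [norm_nonneg magicR]

end StabRank

/-!
Amplitudes of a fixed stabilizer state take only the values `0`, `d`, `-d`, `i d`, `-i d` for one
scalar `d` (`IsStabilizerState.exists_amplitudes`). Hence, if `φ` is a combination of `r` stabilizer
states, the sum of any subset of `m` chosen amplitudes of `φ` is determined by `r` Gaussian integers
with real and imaginary parts at most `m` in absolute value. When each chosen amplitude exceeds in
modulus the sum of the later ones, the `2^m` subset sums are distinct, so `2^m ≤ (2m+1)^(2r)`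
(`HasStabilizerDecomposition.two_pow_card_le`), which forces `r` to be of order `m / log m`.

It remains to find `m` of order `√n` such amplitudes in every `φ` with `‖|B⟩^{⊗n} - φ‖ ≤ 1/8`. The
modulus of the amplitude of `|B⟩^{⊗n}` at `x` depends only on the Hamming weight of `x`, on which it
decreases geometrically, and under the distribution `|⟨x|B^{⊗n}⟩|²` the weight is binomial. By
closeness in norm, weights carrying at least three quarters of this distribution contain some `x` at
which `φ` has the right amplitude up to a factor `1 ± 1/4`. A binomial distribution has no atom of
mass above a constant over `√n` (`binomialMass_mul_sqrt_le`), so there are at least a constant times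
`√n` such weights (`sqrt_le_card_approxWeights`). Keeping the weights of one parity squares the ratio
of consecutive amplitudes, and for `|H⟩` and `|R⟩` the squared ratio is below `3/10`, small enough to
absorb the errors.
-/

namespace StabRank

open Complex

/-! ### Atoms of the binomial distribution -/

/-- The point mass `C(n, w) p^w q^(n-w)` of the binomial distribution. -/
noncomputable def binomialMass (p q : ℝ) (n w : ℕ) : ℝ := n.choose w * p ^ w * q ^ (n - w)

theorem binomialMass_nonneg {p q : ℝ} (hp : 0 ≤ p) (hq : 0 ≤ q) (n w : ℕ) :
    0 ≤ binomialMass p q n w := by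
  unfold binomialMass; positivity

theorem sum_binomialMass {p q : ℝ} (hpq : p + q = 1) (n : ℕ) :
    ∑ w ∈ Finset.range (n + 1), binomialMass p q n w = 1 := by
  have h := add_pow p q n
  rw [hpq, one_pow] at h
  rw [h]
  exact Finset.sum_congr rfl fun w _ => by unfold binomialMass; ring

theorem binomialMass_of_lt {p q : ℝ} {n w : ℕ} (h : n < w) : binomialMass p q n w = 0 := by
  simp [binomialMass, Nat.choose_eq_zero_of_lt h]

theorem binomialMass_swap (p q : ℝ) {n w : ℕ} (h : w ≤ n) :
    binomialMass p q n w = binomialMass q p n (n - w) := by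
  simp only [binomialMass, Nat.choose_symm h, Nat.sub_sub_self h]
  ring

theorem binomialMass_succ (p q : ℝ) (n w : ℕ) :
    binomialMass p q n (w + 1) * ((w + 1) * q) = binomialMass p q n w * ((n - w) * p) := by
  rcases lt_or_ge w n with h | h
  · have hc : (n.choose (w + 1) : ℝ) * (w + 1) = n.choose w * (n - w) := by
      have := Nat.choose_succ_right_eq n w
      rw [← Nat.cast_sub h.le]
      exact_mod_cast this
    have hq : q ^ (n - w) = q ^ (n - (w + 1)) * q := by
      rw [← pow_succ]; congr 1; omega
    unfold binomialMass
    rw [hq, pow_succ]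
    linear_combination (p ^ w * p * q ^ (n - (w + 1)) * q) * hc
  · rw [binomialMass_of_lt (by omega : n < w + 1)]
    rcases h.eq_or_lt with rfl | h
    · simp
    · simp [binomialMass_of_lt h]

/-- To the right of a point `w` left of the mean, the mass decays at most like a geometric sequence
of ratio `1 - K / (n p q)` over `K` steps. -/
theorem binomialMass_mul_pow_le {p q : ℝ} (hp : 0 < p) (hq : 0 < q) (hpq : p + q = 1) {n w K : ℕ}
    (hw : (w : ℝ) ≤ n * p) (hK : (K : ℝ) ≤ n * p * q) {j : ℕ} (hj : j ≤ K) :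
    binomialMass p q n w * (1 - K / (n * p * q)) ^ j ≤ binomialMass p q n (w + j) := by
  induction j with
  | zero => simp
  | succ j ih =>
    have ih := ih (by omega)
    have hjK : (j : ℝ) + 1 ≤ K := by exact_mod_cast hj
    have hA : 0 < n * p * q := lt_of_lt_of_le (by positivity) (hjK.trans hK)
    set A := n * p * q with hAdef
    have hD : 0 < ((w + j : ℕ) + 1 : ℝ) * q := by positivity
    have hr0 : 0 ≤ 1 - K / A := by rw [sub_nonneg, div_le_one hA]; exact hK
    have hb := binomialMass_nonneg hp.le hq.le n (w + j)
    have hstep : ((w + j : ℕ) + 1 : ℝ) * q * (1 - K / A) ≤ (n - (w + j : ℕ)) * p := by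
      have h1 : ((w + j : ℕ) + 1 : ℝ) * q ≤ A + (j + 1) * q := by
        push_cast
        nlinarith
      have h2 : (A + (j + 1) * q) * (1 - K / A) ≤ A + (j + 1) * q - K := by
        have : (A + (j + 1) * q) * (1 - K / A) = A + (j + 1) * q - K - (j + 1) * q * (K / A) := by
          field_simp
          ring
        rw [this]
        have : 0 ≤ (j + 1) * q * (K / A) := by positivity
        linarith
      have h3 : A - j * p ≤ (n - (w + j : ℕ)) * p := by
        have : q = 1 - p := by linarith
        push_cast
        rw [hAdef, this]
        nlinarith
      have h4 : (j + 1) * q - K ≤ - (j * p) := by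
        have : q = 1 - p := by linarith
        rw [this]
        nlinarith
      have := mul_le_mul_of_nonneg_right h1 hr0
      linarith
    have hs := binomialMass_succ p q n (w + j)
    have : binomialMass p q n (w + j) * (1 - K / A) ≤ binomialMass p q n (w + j + 1) := by
      refine le_of_mul_le_mul_right ?_ hD
      rw [hs]
      calc _ = binomialMass p q n (w + j) * (((w + j : ℕ) + 1 : ℝ) * q * (1 - K / A)) := by ring
        _ ≤ _ := mul_le_mul_of_nonneg_left hstep hb
    calc _ = binomialMass p q n w * (1 - K / A) ^ j * (1 - K / A) := by ring
      _ ≤ binomialMass p q n (w + j) * (1 - K / A) := mul_le_mul_of_nonneg_right ih hr0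
      _ ≤ _ := this

theorem binomialMass_mul_sqrt_le_of_le_mean {p q : ℝ} (hp : 0 < p) (hq : 0 < q) (hpq : p + q = 1)
    {n w : ℕ} (hw : (w : ℝ) ≤ n * p) :
    binomialMass p q n w * √(n * p * q / 2) ≤ 2 := by
  set K := ⌊√(n * p * q / 2)⌋₊ with hKdef
  have hK : (K : ℝ) ≤ √(n * p * q / 2) := Nat.floor_le (Real.sqrt_nonneg _)
  have hK' : √(n * p * q / 2) ≤ K + 1 := (Nat.lt_floor_add_one _).le
  have hA0 : 0 ≤ n * p * q := by positivity
  have hKsq : (K : ℝ) ^ 2 ≤ n * p * q / 2 := by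
    calc (K : ℝ) ^ 2 ≤ √(n * p * q / 2) ^ 2 := by gcongr
      _ = _ := Real.sq_sqrt (by positivity)
  have hKK : (K : ℝ) ≤ (K : ℝ) ^ 2 := by exact_mod_cast Nat.le_self_pow (by norm_num) K
  have hKA : (K : ℝ) ≤ n * p * q := by linarith
  have hb := binomialMass_nonneg hp.le hq.le n w
  have hhalf : ∀ j ∈ Finset.range (K + 1),
      binomialMass p q n w / 2 ≤ binomialMass p q n (w + j) := by
    intro j hj
    have hj : j ≤ K := by simpa [Nat.lt_succ_iff] using hj
    refine le_trans ?_ (binomialMass_mul_pow_le hp hq hpq hw hKA hj)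
    have hd : (K : ℝ) / (n * p * q) ≤ 1 := div_le_one_of_le₀ hKA hA0
    have hb1 := one_add_mul_le_pow (a := -((K : ℝ) / (n * p * q))) (by linarith) j
    have hjd : (j : ℝ) * (K / (n * p * q)) ≤ 1 / 2 := by
      calc (j : ℝ) * (K / (n * p * q)) ≤ K * (K / (n * p * q)) := by gcongr
        _ = (K : ℝ) ^ 2 / (n * p * q) := by ring
        _ ≤ 1 / 2 := div_le_of_le_mul₀ hA0 (by norm_num) (by linarith)
    have : 1 / 2 ≤ (1 - (K : ℝ) / (n * p * q)) ^ j := by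
      rw [sub_eq_add_neg]; linarith
    nlinarith
  have hsum : ∑ j ∈ Finset.range (K + 1), binomialMass p q n (w + j) ≤ 1 := by
    rw [← sum_binomialMass hpq n, ← Finset.sum_image (f := fun i => binomialMass p q n i)
      (g := fun j => w + j) (fun _ _ _ _ h => by simpa using h)]
    have hu : ∑ i ∈ Finset.range (n + 1), binomialMass p q n i = ∑ i ∈
        Finset.range (n + 1) ∪ (Finset.range (K + 1)).image (fun j => w + j),
        binomialMass p q n i := by
      refine Finset.sum_subset Finset.subset_union_left fun i _ hi => ?_
      exact binomialMass_of_lt (by simpa [Nat.lt_succ_iff] using hi)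
    rw [hu]
    exact Finset.sum_le_sum_of_subset_of_nonneg Finset.subset_union_right
      fun i _ _ => binomialMass_nonneg hp.le hq.le n i
  have := Finset.card_nsmul_le_sum _ _ _ hhalf
  rw [Finset.card_range, nsmul_eq_mul] at this
  push_cast at this
  nlinarith

/-- The binomial distribution has no atom heavier than a constant over its standard deviation. -/
theorem binomialMass_mul_sqrt_le {p q : ℝ} (hp : 0 < p) (hq : 0 < q) (hpq : p + q = 1) (n w : ℕ) :
    binomialMass p q n w * √(n * p * q / 2) ≤ 2 := by
  rcases lt_or_ge n w with h | h
  · simp [binomialMass_of_lt h]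
  rcases le_total (w : ℝ) (n * p) with hw | hw
  · exact binomialMass_mul_sqrt_le_of_le_mean hp hq hpq hw
  · rw [binomialMass_swap p q h, show n * p * q / 2 = n * q * p / 2 by ring]
    refine binomialMass_mul_sqrt_le_of_le_mean hq hp (by linarith) ?_
    rw [Nat.cast_sub h]
    have : q = 1 - p := by linarith
    rw [this]; nlinarith

/-! ### Amplitudes of stabilizer states -/

theorem pauliOne_entry {σ : Matrix (Fin 2) (Fin 2) ℂ} (h : σ ∈ pauliOne) {a b : Fin 2}
    (hab : σ a b ≠ 0) : (∃ k : ℕ, σ a b = I ^ k) ∧ ∀ b', b' ≠ b → σ a b' = 0 := by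
  obtain ⟨k, P, hP, rfl⟩ := h
  have hI3 : -I = I ^ 3 := by simp [pow_succ]
  have key : (∃ k : ℕ, P a b = I ^ k) ∧ ∀ b', b' ≠ b → P a b' = 0 := by
    rcases hP with rfl | rfl | rfl | rfl <;> fin_cases a <;> fin_cases b <;>
      simp [pauliX, pauliY, pauliZ, Fin.forall_fin_two] at hab ⊢ <;>
      first
      | (refine ⟨0, ?_⟩; simp; done)
      | (refine ⟨1, ?_⟩; simp; done)
      | (refine ⟨2, ?_⟩; simp; done)
      | exact ⟨3, hI3⟩
  obtain ⟨⟨l, hl⟩, h0⟩ := key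
  exact ⟨⟨k + l, by simp [hl, pow_add]⟩, fun b' hb' => by simp [h0 b' hb']⟩

/-- Pauli operators are monomial matrices whose nonzero entries are powers of `i`. -/
theorem pauliGroup_entry {n : ℕ} {P : QMat n} (h : P ∈ pauliGroup n) {x y : Bits n}
    (hxy : P x y ≠ 0) : (∃ k : ℕ, P x y = I ^ k) ∧ ∀ y', y' ≠ y → P x y' = 0 := by
  obtain ⟨σ, hσ, rfl⟩ := h
  simp only [tensorMat, Matrix.of_apply] at hxy ⊢
  have hj : ∀ j, σ j (x j) (y j) ≠ 0 := fun j => Finset.prod_ne_zero_iff.mp hxy j (Finset.mem_univ j)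
  constructor
  · choose k hk using fun j => (pauliOne_entry (hσ j) (hj j)).1
    exact ⟨∑ j, k j, by rw [← Finset.prod_pow_eq_pow_sum]; exact Finset.prod_congr rfl fun j _ => hk j⟩
  · intro y' hy'
    obtain ⟨j, hne⟩ := Function.ne_iff.mp hy'
    exact Finset.prod_eq_zero (Finset.mem_univ j) ((pauliOne_entry (hσ j) (hj j)).2 _ hne)

/-- The operator `Z^z = Z^{z₁} ⊗ ⋯ ⊗ Z^{zₙ}`. -/
noncomputable def zString {n : ℕ} (z : Bits n) : QMat n :=
  tensorMat fun j => if z j = 0 then 1 else pauliZ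

theorem zString_mem {n : ℕ} (z : Bits n) : zString z ∈ pauliGroup n := by
  refine ⟨_, fun j => ?_, rfl⟩
  split_ifs
  · exact ⟨0, 1, by simp, by simp⟩
  · exact ⟨0, pauliZ, by simp, by simp⟩

theorem zString_apply_zero {n : ℕ} (z x : Bits n) :
    zString z x 0 = (1 : QMat n) x 0 := by
  rw [← tensorMat_one]
  simp only [zString, tensorMat, Matrix.of_apply]
  refine Finset.prod_congr rfl fun j _ => ?_
  split_ifs
  · rfl
  · change pauliZ (x j) 0 = (1 : Matrix (Fin 2) (Fin 2) ℂ) (x j) 0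
    rcases Fin.exists_fin_two.mp ⟨x j, rfl⟩ with h | h <;> rw [h] <;> simp [pauliZ]

/-- Up to the factor `2ⁿ`, the projector `|0ⁿ⟩⟨0ⁿ|` is the sum of all `Z^z`. -/
theorem sum_zString {n : ℕ} (x y : Bits n) :
    ∑ z, zString z x y = if x = 0 ∧ y = 0 then 2 ^ n else 0 := by
  have h := Finset.prod_univ_sum (fun _ : Fin n => (Finset.univ : Finset (Fin 2)))
    (fun j a => (if a = 0 then (1 : Matrix (Fin 2) (Fin 2) ℂ) else pauliZ) (x j) (y j))
  simp only [Fintype.piFinset_univ] at h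
  simp only [zString, tensorMat, Matrix.of_apply]
  rw [← h]
  have h2 : ∀ j, ∑ a : Fin 2, (if a = 0 then (1 : Matrix (Fin 2) (Fin 2) ℂ) else pauliZ) (x j) (y j)
      = if x j = 0 ∧ y j = 0 then 2 else 0 := by
    intro j
    generalize x j = a
    generalize y j = b
    fin_cases a <;> fin_cases b <;> simp [pauliZ]
    norm_num
  simp only [h2]
  rw [Finset.prod_ite_zero]
  simp [funext_iff, forall_and]

/-- Any two nonzero amplitudes of a stabilizer state differ by a power of `i`. If `U` is the Clifford
unitary preparing the state `φ`, then `|φ⟩⟨φ|` is a multiple of the sum of the Pauli operators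
`U Z^z U†`, so one of them has a nonzero entry where `|φ⟩⟨φ|` has one; being monomial and fixing `φ`,
it carries one amplitude to the other. -/
theorem IsStabilizerState.exists_eq_I_pow_mul {n : ℕ} {φ : QSpace n} (h : IsStabilizerState φ)
    {x y : Bits n} (hx : φ x ≠ 0) (hy : φ y ≠ 0) : ∃ k : ℕ, φ x = I ^ k * φ y := by
  obtain ⟨U, ⟨hU, hP⟩, hφ⟩ := h
  have hφ' : ∀ x, φ x = U x 0 := by
    intro x
    rw [hφ]
    simp [ket, Matrix.toEuclideanLin]
  have hUU : star U * U = 1 := Matrix.mem_unitaryGroup_iff'.mp hU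
  have hsum : ∑ z, (U * zString z * star U : QMat n) x y = 2 ^ n * (φ x * star (φ y)) := by
    simp only [Matrix.mul_apply, Finset.sum_mul]
    rw [Finset.sum_comm]
    simp_rw [Finset.sum_comm (s := (Finset.univ : Finset (Bits n))) (t := Finset.univ)
      (f := fun z i => U x i * zString z i _ * star U _ y)]
    simp_rw [← Finset.sum_mul, ← Finset.mul_sum, sum_zString]
    simp [ite_and, hφ', Matrix.star_apply]
    ring
  have hne : ∑ z, (U * zString z * star U : QMat n) x y ≠ 0 := by
    rw [hsum]
    exact mul_ne_zero (pow_ne_zero _ two_ne_zero) (mul_ne_zero hx (star_ne_zero.mpr hy))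
  obtain ⟨z, -, hz⟩ := Finset.exists_ne_zero_of_sum_ne_zero hne
  have hmem : U * zString z * star U ∈ pauliGroup n := hP ▸ ⟨_, zString_mem z, rfl⟩
  obtain ⟨⟨k, hk⟩, h0⟩ := pauliGroup_entry hmem hz
  refine ⟨k, ?_⟩
  have hfix : (U * zString z * star U * U : QMat n) x 0 = U x 0 := by
    rw [Matrix.mul_assoc, hUU, Matrix.mul_one, Matrix.mul_apply]
    simp_rw [zString_apply_zero]
    rw [← Matrix.mul_apply, Matrix.mul_one]
  rw [hφ', hφ', ← hk, ← hfix, Matrix.mul_apply (M := U * zString z * star U)]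
  refine Finset.sum_eq_single y (fun y' _ hy' => by rw [h0 y' hy', zero_mul]) (by simp)

/-- Up to a scalar, the amplitudes of a stabilizer state are Gaussian integers of modulus at most
one, written here through their real and imaginary parts. -/
theorem IsStabilizerState.exists_amplitudes {n : ℕ} {φ : QSpace n} (h : IsStabilizerState φ) :
    ∃ (d : ℂ) (a b : Bits n → ℤ), (∀ x, |a x| ≤ 1) ∧ (∀ x, |b x| ≤ 1) ∧
      ∀ x, φ x = d * (a x + b x * I) := by
  have key : ∃ d : ℂ, ∀ x, ∃ ab : ℤ × ℤ, |ab.1| ≤ 1 ∧ |ab.2| ≤ 1 ∧ φ x = d * (ab.1 + ab.2 * I) := by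
    by_cases h0 : ∃ y, φ y ≠ 0
    · obtain ⟨y, hy⟩ := h0
      refine ⟨φ y, fun x => ?_⟩
      by_cases hx : φ x = 0
      · exact ⟨(0, 0), by simp, by simp, by simp [hx]⟩
      obtain ⟨k, hk⟩ := h.exists_eq_I_pow_mul hx hy
      rw [hk, mul_comm, I_pow_eq_pow_mod]
      have : k % 4 < 4 := Nat.mod_lt _ (by norm_num)
      interval_cases k % 4
      · exact ⟨(1, 0), by simp, by simp, by simp⟩
      · exact ⟨(0, 1), by simp, by simp, by simp⟩
      · exact ⟨(-1, 0), by simp, by simp, by simp⟩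
      · exact ⟨(0, -1), by simp, by simp, by simp⟩
    · push Not at h0
      exact ⟨0, fun x => ⟨(0, 0), by simp, by simp, by simp [h0]⟩⟩
  obtain ⟨d, hd⟩ := key
  choose ab h1 h2 h3 using hd
  exact ⟨d, fun x => (ab x).1, fun x => (ab x).2, h1, h2, h3⟩

/-! ### Counting subset sums of amplitudes -/

/-- Subset sums of a finite family are pairwise distinct if each term exceeds in norm the sum of the
later ones. -/
theorem subset_sum_injOn {I : Finset ℕ} {v : ℕ → ℂ}
    (hv : ∀ k ∈ I, ∑ i ∈ I with k < i, ‖v i‖ < ‖v k‖) :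
    Set.InjOn (fun S => ∑ i ∈ S, v i) (I.powerset : Set (Finset ℕ)) := by
  intro S hS T hT hST
  have hS : S ⊆ I := by simpa using hS
  have hT : T ⊆ I := by simpa using hT
  by_contra hne
  have hD : (symmDiff S T).Nonempty := Finset.symmDiff_nonempty.mpr hne
  set k := (symmDiff S T).min' hD
  have hkD : k ∈ symmDiff S T := Finset.min'_mem _ _
  -- The least index at which the two sets differ dominates the difference of the two sums.
  let a : ℕ → ℂ := fun i => (if i ∈ S then 1 else 0) - (if i ∈ T then 1 else 0)
  have hsum : ∑ i ∈ I, a i * v i = 0 := by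
    simp only [a, sub_mul, ite_mul, one_mul, zero_mul, Finset.sum_sub_distrib, Finset.sum_ite_mem,
      Finset.inter_eq_right.mpr hS, Finset.inter_eq_right.mpr hT]
    exact sub_eq_zero.mpr hST
  have ha : ∀ i, ‖a i‖ ≤ 1 := by
    intro i; simp only [a]; split_ifs <;> simp
  have hak : ‖a k‖ = 1 := by
    rw [Finset.mem_symmDiff] at hkD
    rcases hkD with ⟨h1, h2⟩ | ⟨h1, h2⟩ <;> simp [a, h1, h2]
  have ha0 : ∀ i < k, a i = 0 := by
    intro i hi
    have : i ∉ symmDiff S T := fun h => absurd (Finset.min'_le _ _ h) (not_le.mpr hi)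
    rw [Finset.mem_symmDiff] at this
    simp only [a]
    split_ifs <;> simp <;> tauto
  have hkI : k ∈ I := by
    rw [Finset.mem_symmDiff] at hkD
    rcases hkD with ⟨h1, -⟩ | ⟨h1, -⟩
    exacts [hS h1, hT h1]
  have hsplit : a k * v k + ∑ i ∈ I with k < i, a i * v i = 0 := by
    rw [← hsum, ← Finset.add_sum_erase _ _ hkI]
    congr 1
    refine Finset.sum_subset (fun i hi => ?_) (fun i hi hi' => ?_)
    · rw [Finset.mem_filter] at hi
      exact Finset.mem_erase.mpr ⟨hi.2.ne', hi.1⟩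
    · rw [Finset.mem_erase] at hi
      have : ¬ k < i := fun h => hi' (Finset.mem_filter.mpr ⟨hi.2, h⟩)
      rw [ha0 i (by omega), zero_mul]
  have : ‖v k‖ ≤ ∑ i ∈ I with k < i, ‖v i‖ := by
    calc ‖v k‖ = ‖a k * v k‖ := by rw [norm_mul, hak, one_mul]
      _ = ‖∑ i ∈ I with k < i, a i * v i‖ := by
        rw [eq_neg_of_add_eq_zero_left hsplit, norm_neg]
      _ ≤ ∑ i ∈ I with k < i, ‖a i * v i‖ := norm_sum_le _ _
      _ ≤ _ := Finset.sum_le_sum fun i _ => by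
        rw [norm_mul]; exact mul_le_of_le_one_left (norm_nonneg _) (ha i)
  exact absurd (hv k hkI) (not_lt.mpr this)

/-- A vector of stabilizer rank at most `r` has few amplitudes of widely different magnitudes: the
`2^m` subset sums of `m` of them are determined by `2r` integers of modulus at most `m`. -/
theorem HasStabilizerDecomposition.two_pow_card_le {n r : ℕ} {φ : QSpace n}
    (h : HasStabilizerDecomposition φ r) (I : Finset ℕ) (x : ℕ → Bits n)
    (hx : ∀ k ∈ I, ∑ i ∈ I with k < i, ‖φ (x i)‖ < ‖φ (x k)‖) :
    2 ^ I.card ≤ (2 * I.card + 1) ^ (2 * r) := by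
  obtain ⟨c, s, hs, rfl⟩ := h
  choose d a b ha hb hab using fun j => (hs j).exists_amplitudes
  set m : ℤ := (I.card : ℤ) with hm
  let box : Finset (Fin r → ℤ × ℤ) :=
    Fintype.piFinset fun _ => Finset.Icc (-m) m ×ˢ Finset.Icc (-m) m
  have hbox : box.card = (2 * I.card + 1) ^ (2 * r) := by
    have : (m + 1 - -m).toNat = 2 * I.card + 1 := by omega
    simp only [box, Fintype.card_piFinset_const, Finset.card_product, Int.card_Icc, this]
    rw [← sq, ← pow_mul]
  rw [← Finset.card_powerset, ← hbox]
  have hbound : ∀ f : Bits n → ℤ, (∀ x, |f x| ≤ 1) → ∀ S ⊆ I,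
      ∑ i ∈ S, f (x i) ∈ Finset.Icc (-m) m := by
    intro f hf S hS
    rw [Finset.mem_Icc, ← abs_le]
    calc |∑ i ∈ S, f (x i)| ≤ ∑ i ∈ S, |f (x i)| := Finset.abs_sum_le_sum_abs _ _
      _ ≤ ∑ i ∈ S, 1 := Finset.sum_le_sum fun i _ => hf _
      _ ≤ m := by simp [hm, Finset.card_le_card hS]
  refine Finset.card_le_card_of_injOn
    (fun S j => (∑ i ∈ S, a j (x i), ∑ i ∈ S, b j (x i))) ?_ ?_
  · intro S hS
    have hS : S ⊆ I := by simpa using hS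
    simp only [box, Finset.mem_coe, Fintype.mem_piFinset, Finset.mem_product]
    exact fun j => ⟨hbound _ (ha j) S hS, hbound _ (hb j) S hS⟩
  · intro S hS T hT hST
    refine subset_sum_injOn hx hS hT ?_
    have key : ∀ S : Finset ℕ, ∑ i ∈ S, (∑ j, c j • s j : QSpace n) (x i) =
        ∑ j, c j * d j * (((∑ i ∈ S, a j (x i) : ℤ) : ℂ) + ((∑ i ∈ S, b j (x i) : ℤ) : ℂ) * Complex.I) := by
      intro S
      simp only [WithLp.ofLp_sum, Finset.sum_apply, PiLp.smul_apply, smul_eq_mul, hab]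
      rw [Finset.sum_comm]
      refine Finset.sum_congr rfl fun j _ => ?_
      push_cast
      rw [Finset.sum_mul, ← Finset.sum_add_distrib, Finset.mul_sum]
      exact Finset.sum_congr rfl fun i _ => by ring
    simp only [key]
    refine Finset.sum_congr rfl fun j _ => ?_
    have hj := congrFun hST j
    simp only [Prod.mk.injEq] at hj
    rw [hj.1, hj.2]

/-! ### Vectors close to a product state -/

/-- The Hamming weight of a bit string. -/
def weight {n : ℕ} (x : Bits n) : ℕ := (Finset.univ.filter fun j => x j = 1).card

theorem weight_le {n : ℕ} (x : Bits n) : weight x ≤ n :=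
  (Finset.card_le_univ _).trans_eq (Fintype.card_fin n)

theorem card_weight_eq (n w : ℕ) :
    (Finset.univ.filter fun x : Bits n => weight x = w).card = n.choose w := by
  have h := Finset.card_powersetCard w (Finset.univ : Finset (Fin n))
  rw [Finset.card_univ, Fintype.card_fin] at h
  rw [← h]
  refine Finset.card_nbij' (fun x => Finset.univ.filter fun j => x j = 1)
    (fun s j => if j ∈ s then 1 else 0) ?_ ?_ ?_ ?_
  · intro x hx
    simpa [Finset.mem_powersetCard, weight] using (Finset.mem_filter.mp (Finset.mem_coe.mp hx)).2
  · intro s hs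
    refine Finset.mem_coe.mpr (Finset.mem_filter.mpr ⟨Finset.mem_univ _, ?_⟩)
    simpa [Finset.mem_powersetCard, weight] using hs
  · intro x _
    funext j
    rcases Fin.exists_fin_two.mp ⟨x j, rfl⟩ with h | h <;> simp [h]
  · intro s _
    ext j
    simp

theorem norm_tensorPow_apply {n : ℕ} (B : EuclideanSpace ℂ (Fin 2)) (x : Bits n) :
    ‖tensorPow n B x‖ = ‖B 1‖ ^ weight x * ‖B 0‖ ^ (n - weight x) := by
  have h : ∀ j, ‖B (x j)‖ = if x j = 1 then ‖B 1‖ else ‖B 0‖ := by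
    intro j
    rcases Fin.exists_fin_two.mp ⟨x j, rfl⟩ with h | h <;> simp [h]
  have hc : (Finset.univ.filter fun j => ¬ x j = 1).card = n - weight x := by
    rw [← Finset.compl_filter, Finset.card_compl, Fintype.card_fin, weight]
  simp only [tensorPow, norm_prod, h, Finset.prod_ite, Finset.prod_const, hc]
  rfl

theorem sum_norm_sq_tensorPow {n : ℕ} (B : EuclideanSpace ℂ (Fin 2)) (w : ℕ) :
    ∑ x : Bits n with weight x = w, ‖tensorPow n B x‖ ^ 2 =
      binomialMass (‖B 1‖ ^ 2) (‖B 0‖ ^ 2) n w := by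
  have : ∀ x ∈ Finset.univ.filter (fun x : Bits n => weight x = w),
      ‖tensorPow n B x‖ ^ 2 = (‖B 1‖ ^ 2) ^ w * (‖B 0‖ ^ 2) ^ (n - w) := by
    intro x hx
    rw [norm_tensorPow_apply, (Finset.mem_filter.mp hx).2]
    ring
  rw [Finset.sum_congr rfl this, Finset.sum_const, card_weight_eq, nsmul_eq_mul, binomialMass]
  ring

/-- The weights at which `φ` approximates some amplitude of `|B⟩^{⊗n}` up to a relative error of
one quarter. -/
def approxWeights {n : ℕ} (B : EuclideanSpace ℂ (Fin 2)) (φ : QSpace n) : Set ℕ :=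
  {w | ∃ x, weight x = w ∧ ‖tensorPow n B x - φ x‖ ≤ ‖tensorPow n B x‖ / 4}

open Classical in
/-- The weights at which `φ` approximates no amplitude of `|B⟩^{⊗n}` carry a quarter of the binomial
distribution at most; the remaining ones are numerous since each carries little mass. -/
theorem sqrt_le_card_approxWeights {n : ℕ} {B : EuclideanSpace ℂ (Fin 2)} (hB : ‖B‖ = 1)
    (h0 : B 0 ≠ 0) (h1 : B 1 ≠ 0) {φ : QSpace n} (hφ : ‖tensorPow n B - φ‖ ≤ 1 / 8) :
    3 / 8 * √(n * ‖B 1‖ ^ 2 * ‖B 0‖ ^ 2 / 2) ≤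
      ((Finset.range (n + 1)).filter (· ∈ approxWeights B φ)).card := by
  set p := ‖B 1‖ ^ 2
  set q := ‖B 0‖ ^ 2
  have hp : 0 < p := by positivity
  have hq : 0 < q := by positivity
  have hpq : p + q = 1 := by
    have := EuclideanSpace.norm_sq_eq B
    rw [hB, Fin.sum_univ_two] at this
    linarith
  set G := (Finset.range (n + 1)).filter (· ∈ approxWeights B φ)
  have hbad : ∑ w ∈ Finset.range (n + 1) with w ∉ approxWeights B φ, binomialMass p q n w
      ≤ 1 / 4 := by
    calc _ ≤ ∑ w ∈ Finset.range (n + 1) with w ∉ approxWeights B φ,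
          ∑ x : Bits n with weight x = w, 16 * ‖tensorPow n B x - φ x‖ ^ 2 := by
          refine Finset.sum_le_sum fun w hw => ?_
          rw [← sum_norm_sq_tensorPow]
          refine Finset.sum_le_sum fun x hx => ?_
          have hx' : ‖tensorPow n B x‖ / 4 < ‖tensorPow n B x - φ x‖ := by
            by_contra h
            exact (Finset.mem_filter.mp hw).2 ⟨x, (Finset.mem_filter.mp hx).2, not_lt.mp h⟩
          nlinarith [norm_nonneg (tensorPow n B x)]
      _ ≤ ∑ w ∈ Finset.range (n + 1),
          ∑ x : Bits n with weight x = w, 16 * ‖tensorPow n B x - φ x‖ ^ 2 :=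
          Finset.sum_le_sum_of_subset_of_nonneg (Finset.filter_subset _ _)
            fun _ _ _ => Finset.sum_nonneg fun _ _ => by positivity
      _ = ∑ x : Bits n, 16 * ‖tensorPow n B x - φ x‖ ^ 2 :=
          Finset.sum_fiberwise_of_maps_to
            (fun x _ => Finset.mem_range.mpr (Nat.lt_succ_of_le (weight_le x))) _
      _ = 16 * ‖tensorPow n B - φ‖ ^ 2 := by
          rw [EuclideanSpace.norm_sq_eq, Finset.mul_sum]; rfl
      _ ≤ 1 / 4 := by nlinarith [norm_nonneg (tensorPow n B - φ)]
  have htot := sum_binomialMass hpq n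
  rw [← Finset.sum_filter_add_sum_filter_not _ (· ∈ approxWeights B φ)] at htot
  have hgood : 3 / 4 ≤ ∑ w ∈ G, binomialMass p q n w := by linarith
  have hle : (∑ w ∈ G, binomialMass p q n w) * √(n * p * q / 2) ≤ G.card * 2 := by
    rw [Finset.sum_mul, ← nsmul_eq_mul G.card (2 : ℝ)]
    exact Finset.sum_le_card_nsmul _ _ _ fun w _ => binomialMass_mul_sqrt_le hp hq hpq n w
  have := mul_le_mul_of_nonneg_right hgood (Real.sqrt_nonneg (n * p * q / 2))
  linarith

/-- Half of a finite set of naturals lies in one residue class modulo two. -/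
theorem exists_parity_class (G : Finset ℕ) {N : ℕ} (hG : G ⊆ Finset.range N) :
    ∃ b, G.card ≤ 2 * ((Finset.range N).filter fun i => 2 * i + b ∈ G).card := by
  have hsub : G ⊆ ((Finset.range N).filter fun i => 2 * i + 0 ∈ G).image (fun i => 2 * i + 0) ∪
      ((Finset.range N).filter fun i => 2 * i + 1 ∈ G).image (fun i => 2 * i + 1) := by
    intro w hw
    have hN := Finset.mem_range.mp (hG hw)
    simp only [Finset.mem_union, Finset.mem_image, Finset.mem_filter, Finset.mem_range]
    rcases Nat.even_or_odd' w with ⟨i, rfl | rfl⟩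
    · exact Or.inl ⟨i, ⟨by omega, hw⟩, rfl⟩
    · exact Or.inr ⟨i, ⟨by omega, hw⟩, rfl⟩
  have h := (Finset.card_le_card hsub).trans (Finset.card_union_le _ _)
  have h0 := Finset.card_image_le (s := (Finset.range N).filter fun i => 2 * i + 0 ∈ G)
    (f := fun i => 2 * i + 0)
  have h1 := Finset.card_image_le (s := (Finset.range N).filter fun i => 2 * i + 1 ∈ G)
    (f := fun i => 2 * i + 1)
  by_contra hcon
  push Not at hcon
  have := hcon 0
  have := hcon 1
  omega

/-- Terms within a quarter of a geometric sequence of ratio at most `3 / 10` exceed the sum of the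
later ones. -/
theorem sum_lt_of_geometric {I : Finset ℕ} {u : ℕ → ℝ} {g s : ℝ} (hg : 0 < g) (hs : 0 < s)
    (hs' : s ≤ 3 / 10) (hl : ∀ i ∈ I, 3 / 4 * (g * s ^ i) ≤ u i)
    (hu : ∀ i ∈ I, u i ≤ 5 / 4 * (g * s ^ i)) {k : ℕ} (hk : k ∈ I) :
    ∑ i ∈ I with k < i, u i < u k := by
  have hsub : I.filter (k < ·) ⊆ Finset.Ico (k + 1) (I.sup id + 1) := by
    intro i hi
    rw [Finset.mem_filter] at hi
    rw [Finset.mem_Ico]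
    exact ⟨hi.2, Nat.lt_succ_of_le (Finset.le_sup (f := id) hi.1)⟩
  have hpow : 0 < s ^ k := by positivity
  have hgeom : ∑ i ∈ I with k < i, s ^ i ≤ 3 / 7 * s ^ k := by
    calc _ ≤ ∑ i ∈ Finset.Ico (k + 1) (I.sup id + 1), s ^ i :=
          Finset.sum_le_sum_of_subset_of_nonneg hsub fun _ _ _ => by positivity
      _ ≤ s ^ (k + 1) / (1 - s) := geom_sum_Ico_le_of_lt_one hs.le (by linarith)
      _ ≤ 3 / 7 * s ^ k := by
          rw [div_le_iff₀ (by linarith), pow_succ]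
          nlinarith
  calc ∑ i ∈ I with k < i, u i ≤ ∑ i ∈ I with k < i, 5 / 4 * g * s ^ i :=
        Finset.sum_le_sum fun i hi =>
          (hu i (Finset.mem_filter.mp hi).1).trans_eq (by ring)
    _ = 5 / 4 * g * ∑ i ∈ I with k < i, s ^ i := by rw [Finset.mul_sum]
    _ ≤ 5 / 4 * g * (3 / 7 * s ^ k) := by gcongr
    _ < 3 / 4 * (g * s ^ k) := by nlinarith [mul_pos hg hpow]
    _ ≤ u k := hl k hk

/-- The counting bound for a vector close to `|B⟩^{⊗n}`. Weights are restricted to one parity class,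
so that consecutive amplitudes decrease by the squared ratio `‖B 1‖² / ‖B 0‖²`. -/
theorem exists_two_pow_le {n r : ℕ} {B : EuclideanSpace ℂ (Fin 2)} (hB : ‖B‖ = 1)
    (h1 : B 1 ≠ 0) (h10 : ‖B 1‖ ^ 2 ≤ 3 / 10 * ‖B 0‖ ^ 2) {φ : QSpace n}
    (hφ : ‖tensorPow n B - φ‖ ≤ 1 / 8) (hr : HasStabilizerDecomposition φ r) :
    ∃ m : ℕ, m ≤ n + 1 ∧ 3 / 16 * √(n * ‖B 1‖ ^ 2 * ‖B 0‖ ^ 2 / 2) ≤ m ∧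
      2 ^ m ≤ (2 * m + 1) ^ (2 * r) := by
  classical
  have hB1 : 0 < ‖B 1‖ := norm_pos_iff.mpr h1
  have h0 : B 0 ≠ 0 := by
    rintro h
    rw [h, norm_zero] at h10
    nlinarith
  have hB0 : 0 < ‖B 0‖ := norm_pos_iff.mpr h0
  have hcard := sqrt_le_card_approxWeights hB h0 h1 hφ
  set G := (Finset.range (n + 1)).filter (· ∈ approxWeights B φ)
  obtain ⟨b, hb⟩ := exists_parity_class G (Finset.filter_subset _ _)
  set I := (Finset.range (n + 1)).filter fun i => 2 * i + b ∈ G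
  have hx : ∀ i, ∃ x : Bits n, i ∈ I → weight x = 2 * i + b ∧
      ‖tensorPow n B x - φ x‖ ≤ ‖tensorPow n B x‖ / 4 := by
    intro i
    by_cases hi : i ∈ I
    · obtain ⟨x, hx⟩ := (Finset.mem_filter.mp (Finset.mem_filter.mp hi).2).2
      exact ⟨x, fun _ => hx⟩
    · exact ⟨0, fun h => absurd h hi⟩
  choose x hx using hx
  set s := ‖B 1‖ ^ 2 / ‖B 0‖ ^ 2 with hsdef
  set g := ‖B 0‖ ^ n * (‖B 1‖ / ‖B 0‖) ^ b with hgdef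
  have hψ : ∀ i ∈ I, ‖tensorPow n B (x i)‖ = g * s ^ i := by
    intro i hi
    have hw := weight_le (x i)
    rw [norm_tensorPow_apply, pow_sub₀ _ hB0.ne' hw, (hx i hi).1, hgdef, hsdef, ← div_pow, ← pow_mul]
    simp only [div_pow, pow_add]
    field_simp
  refine ⟨I.card, (Finset.card_filter_le _ _).trans_eq (Finset.card_range _), ?_,
    hr.two_pow_card_le I x fun k hk => ?_⟩
  · have : (G.card : ℝ) ≤ 2 * I.card := by exact_mod_cast hb
    linarith
  · refine sum_lt_of_geometric (u := fun i => ‖φ (x i)‖) (g := g) (s := s) (by positivity)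
      (by positivity) ?_ (fun i hi => ?_) (fun i hi => ?_) hk
    · rw [hsdef, div_le_iff₀ (by positivity)]
      exact h10
    · have h2 := (hx i hi).2
      have h3 := norm_sub_norm_le (tensorPow n B (x i)) (φ (x i))
      rw [hψ i hi] at h2 h3
      linarith
    · have h2 := (hx i hi).2
      have h3 := norm_sub_norm_le (φ (x i)) (tensorPow n B (x i))
      rw [norm_sub_rev, hψ i hi] at h3
      rw [hψ i hi] at h2
      linarith

/-! ### The lower bound -/

/-- The minimum defining `χ_δ` is attained, so that it is the length of a stabilizer decomposition
of some vector near `ψ`. -/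
theorem exists_decomposition_of_approxStabilizerRank {n : ℕ} {δ : ℝ} (hδ : 0 ≤ δ) {ψ : QSpace n}
    (hψ : ‖ψ‖ = 1) :
    ∃ φ : QSpace n, ‖ψ - φ‖ ≤ δ ∧ HasStabilizerDecomposition φ (approxStabilizerRank δ ψ) := by
  have hne : {r : ℕ | ∃ φ : QSpace n, ‖φ‖ = 1 ∧ ‖ψ - φ‖ ≤ δ ∧ r = stabilizerRank φ}.Nonempty :=
    ⟨_, ψ, hψ, by simpa using hδ, rfl⟩
  obtain ⟨φ, -, hφ, hr⟩ := Nat.sInf_mem hne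
  have hmem : HasStabilizerDecomposition φ (stabilizerRank φ) :=
    Nat.sInf_mem (exists_hasStabilizerDecomposition φ)
  rw [← hr] at hmem
  exact ⟨φ, hφ, hmem⟩

theorem le_approxStabilizerRank_tensorPow {B : EuclideanSpace ℂ (Fin 2)} (hB : ‖B‖ = 1)
    (h1 : B 1 ≠ 0) (h10 : ‖B 1‖ ^ 2 ≤ 3 / 10 * ‖B 0‖ ^ 2) :
    ∃ c : ℝ, 0 < c ∧ ∀ n : ℕ, 3 ≤ n →
      c * (√n / Real.log n) ≤ (approxStabilizerRank (1 / 8) (tensorPow n B) : ℝ) := by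
  have hB1 : 0 < ‖B 1‖ ^ 2 := by positivity
  have hB0 : 0 < ‖B 0‖ ^ 2 := by linarith
  set C := √(‖B 1‖ ^ 2 * ‖B 0‖ ^ 2 / 2) with hC
  have hC0 : 0 < C := Real.sqrt_pos.mpr (by positivity)
  have hlog2 : 0 < Real.log 2 := Real.log_pos (by norm_num)
  refine ⟨3 / 64 * C * Real.log 2, by positivity, fun n hn => ?_⟩
  obtain ⟨φ, hφ, hr⟩ := exists_decomposition_of_approxStabilizerRank (by norm_num : (0 : ℝ) ≤ 1 / 8)
    (norm_tensorPow n hB)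
  set r := approxStabilizerRank (1 / 8) (tensorPow n B)
  obtain ⟨m, hmn, hm, hpow⟩ := exists_two_pow_le hB h1 h10 hφ hr
  have hsqrt : √(n * ‖B 1‖ ^ 2 * ‖B 0‖ ^ 2 / 2) = √n * C := by
    rw [hC, ← Real.sqrt_mul (by positivity)]
    congr 1
    ring
  rw [hsqrt] at hm
  have hn3 : (3 : ℝ) ≤ n := by exact_mod_cast hn
  have hmn' : (m : ℝ) ≤ n + 1 := by exact_mod_cast hmn
  have hlogn : 0 < Real.log n := Real.log_pos (by linarith)
  have hlogm : Real.log (2 * m + 1) ≤ 2 * Real.log n := by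
    calc Real.log (2 * m + 1) ≤ Real.log ((n : ℝ) ^ 2) :=
          Real.log_le_log (by positivity) (by nlinarith)
      _ = 2 * Real.log n := by rw [Real.log_pow]; norm_num
  have hpow' : (2 : ℝ) ^ m ≤ (2 * m + 1) ^ (2 * r) := by exact_mod_cast hpow
  have hlog := Real.log_le_log (by positivity) hpow'
  rw [Real.log_pow, Real.log_pow] at hlog
  push_cast at hlog
  have hlog' : m * Real.log 2 ≤ r * (4 * Real.log n) := by
    calc _ ≤ 2 * (r : ℝ) * Real.log (2 * m + 1) := hlog
      _ ≤ 2 * (r : ℝ) * (2 * Real.log n) := by gcongr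
      _ = _ := by ring
  rw [← mul_div_assoc, div_le_iff₀ hlogn]
  have := mul_le_mul_of_nonneg_right hm hlog2.le
  linarith

/-! ### The two magic states -/

theorem magicH_bounds : magicH 1 ≠ 0 ∧ ‖magicH 1‖ ^ 2 ≤ 3 / 10 * ‖magicH 0‖ ^ 2 := by
  have hpi := Real.pi_pos
  have hs : 0 < Real.sin (Real.pi / 8) := Real.sin_pos_of_pos_of_lt_pi (by linarith) (by linarith)
  have e0 : magicH 0 = (Real.cos (Real.pi / 8) : ℂ) := rfl
  have e1 : magicH 1 = (Real.sin (Real.pi / 8) : ℂ) := rfl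
  rw [e0, e1]
  refine ⟨ofReal_ne_zero.mpr hs.ne', ?_⟩
  simp only [norm_real, Real.norm_eq_abs, sq_abs]
  have hc := Real.cos_sq (Real.pi / 8)
  rw [show 2 * (Real.pi / 8) = Real.pi / 4 by ring, Real.cos_pi_div_four] at hc
  rw [Real.sin_sq, hc]
  have : (1.4 : ℝ) ≤ √2 := Real.le_sqrt_of_sq_le (by norm_num)
  linarith

theorem magicR_bounds : magicR 1 ≠ 0 ∧ ‖magicR 1‖ ^ 2 ≤ 3 / 10 * ‖magicR 0‖ ^ 2 := by
  have h3 : (0 : ℝ) < √3 := by positivity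
  have h3l : (1.7 : ℝ) ≤ √3 := Real.le_sqrt_of_sq_le (by norm_num)
  have h3u : √3 ≤ 1.75 := Real.sqrt_le_iff.mpr (by norm_num)
  have hinv : 1 / √3 < 1 := by rw [div_lt_one h3]; linarith
  have hinv' : 4 / 7 ≤ 1 / √3 := by rw [le_div_iff₀ h3]; linarith
  have hc : Real.cos magicAngle ^ 2 = 1 / 2 + 1 / √3 / 2 := by
    rw [Real.cos_sq, magicAngle, mul_div_cancel₀ _ (by norm_num : (2 : ℝ) ≠ 0),
      Real.cos_arccos (by linarith) hinv.le]
  have e0 : magicR 0 = (Real.cos magicAngle : ℂ) := rfl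
  have e1 : magicR 1 = exp (I * (Real.pi / 4)) * (Real.sin magicAngle : ℂ) := rfl
  have hn : ‖magicR 1‖ ^ 2 = Real.sin magicAngle ^ 2 := by
    have : I * (Real.pi / 4 : ℂ) = ((Real.pi / 4 : ℝ) : ℂ) * I := by push_cast; ring
    rw [e1, norm_mul, this, norm_exp_ofReal_mul_I, one_mul, norm_real, Real.norm_eq_abs, sq_abs]
  rw [Real.sin_sq, hc] at hn
  constructor
  · intro h
    rw [h, norm_zero] at hn
    linarith
  · rw [hn, e0, norm_real, Real.norm_eq_abs, sq_abs, hc]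
    linarith

end StabRank

theorem theorem4p7 :
    ∃ δ : ℝ, 0 < δ ∧
      ∀ B : EuclideanSpace ℂ (Fin 2), B = StabRank.magicH ∨ B = StabRank.magicR →
        ∃ c : ℝ, 0 < c ∧ ∃ N : ℕ, ∀ n : ℕ, N ≤ n →
          c * (Real.sqrt n / Real.log n) ≤
            (StabRank.approxStabilizerRank δ (StabRank.tensorPow n B) : ℝ) := by
  -- With relative error `1/4`, the bad weights have mass at most `(4 δ)²`, which is `1/4` here.
  refine ⟨1 / 8, by norm_num, ?_⟩
  rintro B (rfl | rfl)
  · obtain ⟨c, hc, h⟩ := StabRank.le_approxStabilizerRank_tensorPow StabRank.norm_magicH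
      StabRank.magicH_bounds.1 StabRank.magicH_bounds.2
    exact ⟨c, hc, 3, h⟩
  · obtain ⟨c, hc, h⟩ := StabRank.le_approxStabilizerRank_tensorPow StabRank.norm_magicR
      StabRank.magicR_bounds.1 StabRank.magicR_bounds.2
    exact ⟨c, hc, 3, h⟩
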